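/- Let $G$ be a finite group, and consider the orbifold $X$ that consists of one point with the trivial action of $G$, i.e. the orbifold with uniformizing system $(\mathbb C^0,G)$, $G$ acting trivially. For $g\in G$ let $(g)$ be its conjugacy class and $C(g)$ its centralizer. The sector $X_{(g)}$ is a point with the trivial action of $C(g)$. Use complex coefficients, $H^*_{orb}(X)=\bigoplus_{(g)}H^{*-2\iota_{(g)}}(X_{(g)})$, where $\iota_{(g)}$ is the degree shifting number, and let $x_{(g)}\in H^*_{orb}(X)$ be the class of the constant function $1$ on $X_{(g)}$. Let $\langle\alpha,\beta\rangle=\sum_{(g)}\int^{orb}_{X_{(g)}}\alpha\wedge I^*\beta$ be the orbifold Poincaré pairing, where $I:X_{(g)}\to X_{(g^{-1})}$ is the canonical identification. Let $\cup$ be the orbifold cup product, that is, $\alpha\cup\beta$ is the class determined by $$\langle\alpha\cup\beta,\gamma\rangle=\langle\alpha,\beta,\gamma\rangle=\sum_{(g_1,g_2,g_3),\ g_1g_2g_3=1}\ \int^{orb}_{X_{(g_1,g_2,g_3)}}e_1^*\alpha\wedge e_2^*\beta\wedge e_3^*\gamma\wedge e(E)\quad\text{for all }\gamma,$$ where the sum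 is over simultaneous conjugacy classes of triples, $X_{(g_1,g_2,g_3)}$ is a point with the trivial action of $C(g_1)\cap C(g_2)\cap C(g_3)$, $e_i:X_{(g_1,g_2,g_3)}\to X_{(g_i)}$ is the evaluation map, $E=(H^1(\Sigma)\otimes TX)^{\langle g_1,g_2,g_3\rangle}$ is the obstruction bundle ($\Sigma$ being the branched covering of the sphere with monodromy $g_1,g_2,g_3$), and orbifold integrals over a chart are divided by the order of its group. Then: 1. All degree shifting numbers $\iota_{(g)}$ are zero, $H^*_{orb}(X)$ is concentrated in degree $0$, and the $x_{(g)}$, $(g)$ running over the conjugacy classes of $G$, form a basis of it. 2. $\langle x_{(g)},x_{(g^{-1})}\rangle=1/|C(g)|$, and $\langle x_{(g)},x_{(h)}\rangle=0$ if $(h)\ne(g^{-1})$. The relation that defines $\alpha\cup\beta$ has exactly one solution for all $\alpha,\beta$. 3. For all $g_1,g_2\in G$, $$x_{(g_1)}\cup x_{(g_2)}=\sum_{(h_1,h_2)}\frac{|C(h_1h_2)|}{|C(h_1)\cap C(h_2)|}\,x_{(h_1h_2)},$$ where the sum is over the simultaneous conjugacy classes $(h_1,h_2)$ of pairs with $h_1\in(g_1)$,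 $h_2\in(g_2)$; the summands do not depend on the chosen representatives. 4. The map $\Psi:x_{(g)}\mapsto\sum_{h\in(g)}h$ extends to a $\mathbb C$-linear bijection from $H^*_{orb}(X)$ onto the center $Z(\mathbb C[G])$ of the group algebra, with $\Psi(\alpha\cup\beta)=\Psi(\alpha)\Psi(\beta)$ and $\Psi(x_{(1)})=1$. Thus the orbifold cohomology ring of $X$ is identified with $Z(\mathbb C[G])$. -/

import Mathlib

open scoped ContDiff

noncomputable section

namespace OrbifoldCohomology

/-!
## Linear uniformizing systems

An orbifold given by one linear uniformizing system `(V, G)`: a finite group `G` acting (not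
necessarily effectively) on a finite-dimensional complex vector space `V` through `ρ`.
-/

section LinearChart

variable {G : Type*} [Group G] {V : Type*} [NormedAddCommGroup V] [NormedSpace ℂ V]
  [FiniteDimensional ℂ V] (ρ : Representation ℂ G V)

/-- The common fixed-point set `V^S` of the elements of `S`. -/
def fixedSpace (S : Set G) : Submodule ℂ V where
  carrier := {v | ∀ s ∈ S, ρ s v = v}
  add_mem' := fun ha hb s hs => by rw [map_add, ha s hs, hb s hs]
  zero_mem' := fun s _ => map_zero _
  smul_mem' := fun c v hv s hs => by rw [map_smul, hv s hs]

/-- The action of `a` as a map `V^g → V^(a g a⁻¹)`. -/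
def translate (a g : G) : fixedSpace ρ {g} →L[ℝ] fixedSpace ρ {a * g * a⁻¹} :=
  LinearMap.toContinuousLinearMap
    (((ρ a).restrict (p := fixedSpace ρ {g}) (q := fixedSpace ρ {a * g * a⁻¹}) (by
      rintro v hv s rfl
      have h : ρ g v = v := hv g rfl
      rw [← Module.End.mul_apply, ← map_mul, inv_mul_cancel_right, map_mul,
        Module.End.mul_apply, h])).restrictScalars ℝ)

/-- The inclusion `V^S → V^T` when every point fixed by `S` is fixed by `T`. -/
def inclusion {S T : Set G} (h : fixedSpace ρ S ≤ fixedSpace ρ T) :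
    fixedSpace ρ S →L[ℝ] fixedSpace ρ T :=
  LinearMap.toContinuousLinearMap ((Submodule.inclusion h).restrictScalars ℝ)

/-- Pull-back of a complex valued differential form along a linear map. -/
def pullback {E F : Type*} [NormedAddCommGroup E] [NormedSpace ℝ E] [NormedAddCommGroup F]
    [NormedSpace ℝ F] {k : ℕ} (f : E →L[ℝ] F) (w : F → F [⋀^Fin k]→L[ℝ] ℂ) :
    E → E [⋀^Fin k]→L[ℝ] ℂ :=
  fun x => (w (f x)).compContinuousLinearMap f

/-- The sector `X_c` of a conjugacy class `c` has the uniformizing systems `(V^h, C(h))`, `h ∈ c`,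
identified with each other by the elements of `G`.  A family of `k`-forms, one on each of them. -/
abbrev FormFamily (c : ConjClasses G) (k : ℕ) : Type _ :=
  (h : {h : G // ConjClasses.mk h = c}) →
    fixedSpace ρ {h.1} → fixedSpace ρ {h.1} [⋀^Fin k]→L[ℝ] ℂ

/-! Shortcuts to the pointwise vector space structure on families of forms. -/

instance formFamilyAddCommGroup (c : ConjClasses G) (k : ℕ) : AddCommGroup (FormFamily ρ c k) :=
  inferInstance

instance formFamilyModule (c : ConjClasses G) (k : ℕ) : Module ℂ (FormFamily ρ c k) :=
  inferInstance

/-- Conjugation by `a` on the members of a conjugacy class. -/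
def conjMem {c : ConjClasses G} (a : G) (h : {h : G // ConjClasses.mk h = c}) :
    {h : G // ConjClasses.mk h = c} :=
  ⟨a * h.1 * a⁻¹, Eq.trans
    (ConjClasses.mk_eq_mk_iff_isConj.2 (isConj_iff.2 ⟨a, rfl⟩).symm) h.2⟩

theorem extDeriv_add_of_smooth {E : Type*} [NormedAddCommGroup E] [NormedSpace ℝ E] {k : ℕ}
    {w η : E → E [⋀^Fin k]→L[ℝ] ℂ} (hw : ContDiff ℝ ∞ w) (hη : ContDiff ℝ ∞ η) :
    extDeriv (w + η) = extDeriv w + extDeriv η := by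
  funext x
  exact extDeriv_add (hw.differentiable (by simp) x) (hη.differentiable (by simp) x)

theorem extDeriv_smul_of_smooth {E : Type*} [NormedAddCommGroup E] [NormedSpace ℝ E] {k : ℕ}
    {w : E → E [⋀^Fin k]→L[ℝ] ℂ} (hw : ContDiff ℝ ∞ w) (a : ℂ) :
    extDeriv (a • w) = a • extDeriv w := by
  funext x
  have hd : DifferentiableAt ℝ w x := hw.differentiable (by simp) x
  ext v
  rw [Pi.smul_apply, ContinuousAlternatingMap.smul_apply, extDeriv, extDeriv,
    ContinuousAlternatingMap.alternatizeUncurryFin_apply,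
    ContinuousAlternatingMap.alternatizeUncurryFin_apply, fderiv_const_smul hd, Finset.smul_sum]
  refine Finset.sum_congr rfl fun i _ => ?_
  rw [smul_comm a]
  rfl

theorem extDeriv_const_zero {E : Type*} [NormedAddCommGroup E] [NormedSpace ℝ E] {k : ℕ} :
    extDeriv (0 : E → E [⋀^Fin k]→L[ℝ] ℂ) = 0 := by
  funext x
  ext v
  simp [extDeriv, ContinuousAlternatingMap.alternatizeUncurryFin_apply]

/-- Differential `k`-forms on the sector `X_c`: families of smooth forms on the `V^h`, `h ∈ c`,
that are compatible with the action of `G` (so the form on `V^h` is `C(h)`-invariant). -/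
def sectorForms (c : ConjClasses G) (k : ℕ) : Submodule ℂ (FormFamily ρ c k) where
  carrier := {w | (∀ h, ContDiff ℝ ∞ (w h)) ∧
    ∀ h a, pullback (translate ρ a h.1) (w (conjMem a h)) = w h}
  add_mem' := fun {w η} hw hη => ⟨fun h => (hw.1 h).add (hη.1 h), fun h a => by
    rw [Pi.add_apply w η h, ← hw.2 h a, ← hη.2 h a]; rfl⟩
  zero_mem' := ⟨fun _ => contDiff_const, fun _ _ => by funext x; ext v; rfl⟩
  smul_mem' := fun a w hw => ⟨fun h => (hw.1 h).const_smul a, fun h b => by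
    rw [Pi.smul_apply a w h, ← hw.2 h b]; rfl⟩

/-- Closed `k`-forms on the sector `X_c`. -/
def closedForms (c : ConjClasses G) (k : ℕ) : Submodule ℂ (FormFamily ρ c k) where
  carrier := {w | w ∈ sectorForms ρ c k ∧ ∀ h, extDeriv (w h) = 0}
  add_mem' := fun {w η} hw hη => ⟨add_mem hw.1 hη.1, fun h => by
    rw [Pi.add_apply, extDeriv_add_of_smooth (hw.1.1 h) (hη.1.1 h), hw.2 h, hη.2 h, add_zero]⟩
  zero_mem' := ⟨zero_mem _, fun _ => extDeriv_const_zero⟩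
  smul_mem' := fun a w hw => ⟨Submodule.smul_mem _ a hw.1, fun h => by
    rw [Pi.smul_apply, extDeriv_smul_of_smooth (hw.1.1 h), hw.2 h, smul_zero]⟩

/-- Exact `k`-forms on the sector `X_c`. -/
def exactForms (c : ConjClasses G) : (k : ℕ) → Submodule ℂ (FormFamily ρ c k)
  | 0 => ⊥
  | k + 1 =>
    { carrier := {w | ∃ η ∈ sectorForms ρ c k, ∀ h, w h = extDeriv (η h)}
      add_mem' := fun {w w'} ⟨η, hη, e⟩ ⟨η', hη', e'⟩ => ⟨η + η', add_mem hη hη', fun h => by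
        rw [Pi.add_apply, Pi.add_apply, extDeriv_add_of_smooth (hη.1 h) (hη'.1 h), e, e']⟩
      zero_mem' := ⟨0, zero_mem _, fun _ => extDeriv_const_zero.symm⟩
      smul_mem' := fun a w ⟨η, hη, e⟩ => ⟨a • η, Submodule.smul_mem _ a hη, fun h => by
        rw [Pi.smul_apply, Pi.smul_apply, extDeriv_smul_of_smooth (hη.1 h), e]⟩ }

/-- The cohomology `H^k(X_c)` of a sector, as de Rham cohomology with complex coefficients. -/
def SectorCohomology (c : ConjClasses G) (k : ℕ) : Type _ :=
  closedForms ρ c k ⧸ (exactForms ρ c k).submoduleOf (closedForms ρ c k)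

instance (c : ConjClasses G) (k : ℕ) : AddCommGroup (SectorCohomology ρ c k) :=
  Submodule.Quotient.addCommGroup _

instance (c : ConjClasses G) (k : ℕ) : Module ℂ (SectorCohomology ρ c k) :=
  Submodule.Quotient.module _

/-- The cohomology class of a closed form. -/
def SectorCohomology.mk (c : ConjClasses G) (k : ℕ) :
    closedForms ρ c k →ₗ[ℂ] SectorCohomology ρ c k :=
  Submodule.mkQ _

theorem SectorCohomology.mk_surjective (c : ConjClasses G) (k : ℕ) :
    Function.Surjective (SectorCohomology.mk ρ c k) :=
  Submodule.mkQ_surjective _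

theorem SectorCohomology.mk_eq_zero (c : ConjClasses G) (k : ℕ) (w : closedForms ρ c k) :
    SectorCohomology.mk ρ c k w = 0 ↔ w.1 ∈ exactForms ρ c k :=
  Submodule.Quotient.mk_eq_zero _

/-- A closed form representing a cohomology class. -/
def SectorCohomology.rep {c : ConjClasses G} {k : ℕ} (a : SectorCohomology ρ c k) :
    closedForms ρ c k :=
  (SectorCohomology.mk_surjective ρ c k a).choose

theorem SectorCohomology.mk_rep {c : ConjClasses G} {k : ℕ} (a : SectorCohomology ρ c k) :
    SectorCohomology.mk ρ c k a.rep = a :=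
  (SectorCohomology.mk_surjective ρ c k a).choose_spec

/-- The total orbifold cohomology group, the direct sum of all `H^k(X_c)`.  (There are finitely
many classes `c`, and `H^k(X_c) = 0` for `k > dim X_c`, so the product is the direct sum.) -/
abbrev OrbCohomology : Type _ :=
  (c : ConjClasses G) → (k : ℕ) → SectorCohomology ρ c k

/-- The degree shifting number of `g`: the sum of the `θ ∈ [0, 1)` over the eigenvalues
`exp (2 π i θ)` of `ρ g`, counted with multiplicity. -/
def degreeShift (g : G) : ℝ :=
  ((LinearMap.charpoly (ρ g)).roots.map
    fun z => Int.fract (Complex.arg z / (2 * Real.pi))).sum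

/-- The subspace `H^d_orb = ⊕_(g) H^(d - 2 ι(g))(X_(g))` of classes of orbifold degree `d`. -/
def orbDegree (d : ℝ) : Submodule ℂ (OrbCohomology ρ) where
  carrier := {α | ∀ (g : G) (k : ℕ), (k : ℝ) ≠ d - 2 * degreeShift ρ g →
    α (ConjClasses.mk g) k = 0}
  add_mem' := fun ha hb g k h => by rw [Pi.add_apply, Pi.add_apply, ha g k h, hb g k h, add_zero]
  zero_mem' := fun _ _ _ => rfl
  smul_mem' := fun a α hα g k h => by rw [Pi.smul_apply, Pi.smul_apply, hα g k h, smul_zero]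

/-- The constant function `1` on the sector `X_c`, as a closed `0`-form. -/
def oneForm (c : ConjClasses G) : closedForms ρ c 0 :=
  ⟨fun _ _ => ContinuousAlternatingMap.constOfIsEmpty ℝ _ (Fin 0) 1,
    ⟨fun _ => contDiff_const, fun _ _ => by funext x; ext v; rfl⟩, fun h => by
      funext x
      rw [extDeriv_constOfIsEmpty]
      ext v
      simp [fderiv_fun_const]⟩

open Classical in
/-- The class `x_(g)` of the constant function `1` on the sector `X_(g)`. -/
def sectorUnit (g : G) : OrbCohomology ρ :=
  Pi.single (ConjClasses.mk g) (Pi.single 0 (SectorCohomology.mk ρ _ 0 (oneForm ρ _)))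

end LinearChart

/-! ## Multi-sectors -/

section MultiSectors

variable (G : Type*) [Group G]

/-- Simultaneous conjugacy of `k`-tuples. -/
def tupleConj (k : ℕ) : Setoid (Fin k → G) where
  r g g' := ∃ a : G, ∀ i, g' i = a * g i * a⁻¹
  iseqv :=
    { refl := fun g => ⟨1, fun i => by simp⟩
      symm := fun {g g'} ⟨a, h⟩ => ⟨a⁻¹, fun i => by rw [h i]; group⟩
      trans := fun {g g' g''} ⟨a, h⟩ ⟨b, h'⟩ => ⟨b * a, fun i => by rw [h' i, h i]; group⟩ }

/-- The set `T_k` of conjugacy classes `(g_1, ..., g_k)` of `k`-tuples. -/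
abbrev TupleClasses (k : ℕ) : Type _ := Quotient (tupleConj G k)

/-- The set `T_3^o` of classes of triples with `g_1 g_2 g_3 = 1`. -/
abbrev TripleClassesOne : Type _ :=
  {t : TupleClasses G 3 // ∃ g : Fin 3 → G, Quotient.mk _ g = t ∧ g 0 * g 1 * g 2 = 1}

variable {G}

/-- A triple representing a class in `T_3^o`. -/
def TripleClassesOne.rep (t : TripleClassesOne G) : Fin 3 → G := t.2.choose

theorem TripleClassesOne.rep_mul (t : TripleClassesOne G) :
    t.rep 0 * t.rep 1 * t.rep 2 = 1 := t.2.choose_spec.2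

/-- The set `T((g₁), (g₂))` of classes of pairs `(h₁, h₂)` with `h₁ ∈ (g₁)`, `h₂ ∈ (g₂)`. -/
def pairClasses (g₁ g₂ : G) : Set (TupleClasses G 2) :=
  {t | ∃ h : Fin 2 → G, Quotient.mk _ h = t ∧ IsConj g₁ (h 0) ∧ IsConj g₂ (h 1)}

/-- The relators `λ_i ^ m_i` (`m_i` the order of `g_i`) and `λ_1 λ_2 λ_3`. -/
def sphereRels (g : Fin 3 → G) : Set (FreeGroup (Fin 3)) :=
  {r | (∃ i, r = FreeGroup.of i ^ orderOf (g i)) ∨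
    r = FreeGroup.of 0 * FreeGroup.of 1 * FreeGroup.of 2}

/-- The orbifold fundamental group of the sphere with three orbifold points of multiplicities
`m_1, m_2, m_3`. -/
abbrev SphereGroup (g : Fin 3 → G) : Type := PresentedGroup (sphereRels g)

/-- The homomorphism `λ_i ↦ g_i`. -/
def sphereHom (g : Fin 3 → G) (hg : g 0 * g 1 * g 2 = 1) : SphereGroup g →* G :=
  PresentedGroup.toGroup (f := g) (by
    rintro r (⟨i, rfl⟩ | rfl)
    · rw [map_pow, FreeGroup.lift_apply_of, pow_orderOf_eq_one]
    · simpa using hg)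

end MultiSectors

/-!
## The point with trivial action of `G`

The uniformizing system is `(ℂ⁰, G)` with `G` acting trivially.  All sectors are zero-dimensional
and compact: only the degree zero components of forms can be integrated, the wedge product of
`0`-forms is their product, and compactly supported cohomology is cohomology.
-/

section Point

/-- The space `ℂ⁰` uniformizing the point. -/
abbrev Pt : Type := EuclideanSpace ℂ (Fin 0)

variable (G : Type*) [Group G]

/-- The trivial action of `G` on the point. -/
abbrev ptRep : Representation ℂ G Pt := Representation.trivial ℂ G Pt

/-- The orbifold cohomology of the point with trivial `G`-action. -/
abbrev PtCohomology : Type _ := OrbCohomology (ptRep G)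

variable {G}

/-- The integral of a `0`-form over `X_S = V^S / C(S)`, in the orbifold sense: the integral over
the zero-dimensional manifold `V^S` divided by the order of the group `C(S)`. -/
def orbIntegral (S : Set G)
    (w : fixedSpace (ptRep G) S → fixedSpace (ptRep G) S [⋀^Fin 0]→L[ℝ] ℂ) : ℂ :=
  (Nat.card (Subgroup.centralizer S) : ℂ)⁻¹ * ∑ᶠ v : fixedSpace (ptRep G) S, w v Fin.elim0

/-- The wedge product of two `0`-forms. -/
def wedge₀ {S : Set G}
    (w η : fixedSpace (ptRep G) S → fixedSpace (ptRep G) S [⋀^Fin 0]→L[ℝ] ℂ) :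
    fixedSpace (ptRep G) S → fixedSpace (ptRep G) S [⋀^Fin 0]→L[ℝ] ℂ :=
  fun v => w v Fin.elim0 • η v

/-- The `0`-form on `V^g` representing the degree zero component of `α` on `X_(g)`. -/
def formAt (α : PtCohomology G) (g : G) :
    fixedSpace (ptRep G) {g} → fixedSpace (ptRep G) {g} [⋀^Fin 0]→L[ℝ] ℂ :=
  (α (ConjClasses.mk g) 0).rep.1 ⟨g, rfl⟩

theorem fixedSpace_le_of_mem {S : Set G} {g : G} (h : g ∈ S) :
    fixedSpace (ptRep G) S ≤ fixedSpace (ptRep G) {g} := by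
  rintro v hv s rfl
  exact hv _ h

theorem fixedSpace_le_inv (g : G) :
    fixedSpace (ptRep G) {g} ≤ fixedSpace (ptRep G) {g⁻¹} := by
  rintro v hv s rfl
  have h : ptRep G g v = v := hv g rfl
  nth_rewrite 1 [← h]
  rw [← Module.End.mul_apply, ← map_mul, inv_mul_cancel, map_one, Module.End.one_apply]

/-- The Poincaré pairing: the sum over the sectors `X_(g)` of the orbifold integrals of
`α ∧ I^* β`, where `I : X_(g) → X_(g⁻¹)` is the identity on points. -/
def pairing (α β : PtCohomology G) : ℂ :=
  ∑ᶠ c : ConjClasses G, orbIntegral {Quotient.out c}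
    (wedge₀ (formAt α (Quotient.out c))
      (pullback (inclusion (ptRep G) (fixedSpace_le_inv (Quotient.out c)))
        (formAt β (Quotient.out c)⁻¹)))

/-- The pull-back `e_i^* α` to the multi-sector `X_(g) = V^g / C(g)` of a triple `g`, where
`e_i : X_(g) → X_(g_i)` is induced by `V^g ⊆ V^(g_i)`. -/
def evalPullback (α : PtCohomology G) (g : Fin 3 → G) (i : Fin 3) :
    fixedSpace (ptRep G) (Set.range g) →
      fixedSpace (ptRep G) (Set.range g) [⋀^Fin 0]→L[ℝ] ℂ :=
  pullback (inclusion (ptRep G) (fixedSpace_le_of_mem (Set.mem_range_self i))) (formAt α (g i))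

/-- The fibre `(H^1(Σ) ⊗ TV)^K` of the obstruction bundle, `TV = ℂ⁰`, `K` the subgroup generated
by the triple `g`.  The group `π₁(Σ)` is the kernel of `λ_i ↦ g_i`, and `H^1(Σ) ⊗ TV` is the space
of homomorphisms from `π₁(Σ)` to `TV`; `K` acts on `π₁(Σ)` through conjugation by lifts.  (As
`TV = ℂ⁰`, taking the Dolbeault group `H^(0,1)(Σ)` for `H^1(Σ)` gives the same, zero, fibre.) -/
def obstructionFibre (g : Fin 3 → G) (hg : g 0 * g 1 * g 2 = 1) :
    Submodule ℂ (Additive (sphereHom g hg).ker →+ Pt) where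
  carrier := {φ | ∀ (a : SphereGroup g) (x : (sphereHom g hg).ker),
    φ (Additive.ofMul ⟨a * x.1 * a⁻¹, (MonoidHom.normal_ker _).conj_mem _ x.2 a⟩) =
      ptRep G (sphereHom g hg a) (φ (Additive.ofMul x))}
  add_mem' := fun ha hb a x => by
    rw [AddMonoidHom.add_apply, AddMonoidHom.add_apply, map_add, ha a x, hb a x]
  zero_mem' := fun a x => by simp
  smul_mem' := fun z φ hφ a x => by
    rw [AddMonoidHom.smul_apply, AddMonoidHom.smul_apply, map_smul, hφ a x]

/-- The degree zero component of the Euler form of the obstruction bundle.  The Euler form of a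
bundle of complex rank `r` has degree `2 r`; over a point it is `1` if `r = 0` and `0` otherwise
(the determinant of the zero curvature matrix of size `r`). -/
def eulerForm (g : Fin 3 → G) (hg : g 0 * g 1 * g 2 = 1) :
    fixedSpace (ptRep G) (Set.range g) →
      fixedSpace (ptRep G) (Set.range g) [⋀^Fin 0]→L[ℝ] ℂ :=
  fun _ => ContinuousAlternatingMap.constOfIsEmpty ℝ _ (Fin 0)
    ((0 : ℂ) ^ Module.finrank ℂ (obstructionFibre g hg))

/-- The 3-point function: the sum over `T_3^o` of the orbifold integrals over the multi-sectors of
`e_1^* α ∧ e_2^* β ∧ e_3^* γ ∧ e(E)`. -/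
def threePoint (α β γ : PtCohomology G) : ℂ :=
  ∑ᶠ t : TripleClassesOne G, orbIntegral (Set.range t.rep)
    (wedge₀ (wedge₀ (wedge₀ (evalPullback α t.rep 0) (evalPullback β t.rep 1))
      (evalPullback γ t.rep 2)) (eulerForm t.rep t.rep_mul))

/-- The relation `⟨δ, γ⟩ = ⟨α, β, γ⟩` for all `γ`, which defines `δ = α ∪ β`. -/
def IsOrbCup (α β δ : PtCohomology G) : Prop :=
  ∀ γ : PtCohomology G, pairing δ γ = threePoint α β γ

/-- The orbifold cup product: the class `δ` with `⟨δ, γ⟩ = ⟨α, β, γ⟩` for all `γ`. -/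
def orbCup (α β : PtCohomology G) : PtCohomology G :=
  @Classical.epsilon _ ⟨fun _ _ => 0⟩ (IsOrbCup α β)

/-- The class `x_(g)` given by the constant function `1` on the sector `X_(g)`. -/
abbrev ptClass (g : G) : PtCohomology G := sectorUnit (ptRep G) g

end Point

end OrbifoldCohomology

end

namespace OrbifoldCohomology

/-! ## Orbit counting -/

/-! Over `ℂ⁰` all geometry disappears: every fixed space is a point, forms of positive degree
vanish, and the obstruction fibre has rank zero, so its Euler form is `1`. A cohomology class is
therefore a function on conjugacy classes (`coeffEquiv`), equivalently a class function on `G`,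
equivalently a central element of `ℂ[G]` (`toCenter`).

What remains is counting. Orbifold integrals weight a class of tuples by the inverse order of its
centralizer, which is the stabilizer under conjugation. By orbit-stabilizer such a weighted sum over
classes is `|G|⁻¹` times the plain sum over tuples. Writing `τ` for the coefficient of `1` in `ℂ[G]`
and `Ψ` for `toCenter`, this gives `⟨α, β⟩ = |G|⁻¹ τ(Ψα Ψβ)` (`pairing_eq_coeff_mul`) and `⟨α, β, γ⟩
= |G|⁻¹ τ(Ψα Ψβ Ψγ)` (`threePoint_eq_coeff_mul`).

Hence the product transported from the center solves the relation defining the cup product, and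
nondegeneracy of the pairing (`eq_of_pairing_eq`) makes it the only solution. The explicit product
formula comes from the same 3-point function, regrouped by simultaneous conjugacy classes of pairs.
-/

/-- A sum over a union of orbits, written through representatives of the orbits. -/
theorem finsum_mem_eq_finsum_orbit_representatives {M X ι : Type*} [Group M] [Finite M]
    [MulAction M X] [Finite ι] (r : ι → X) (Y : Set X)
    (hY : ∀ x, x ∈ Y ↔ ∃ t, x ∈ MulAction.orbit M (r t))
    (hr : ∀ t t', r t ∈ MulAction.orbit M (r t') → t = t')
    (F : X → ℂ) (hF : ∀ (m : M) (x : X), F (m • x) = F x) :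
    ∑ᶠ t, (Nat.card (MulAction.stabilizer M (r t)) : ℂ)⁻¹ * F (r t) =
      (Nat.card M : ℂ)⁻¹ * ∑ᶠ x ∈ Y, F x := by
  have hYU : Y = ⋃ t, MulAction.orbit M (r t) := by
    ext x
    rw [hY, Set.mem_iUnion]
  have hdisj : Pairwise (Function.onFun Disjoint fun t => MulAction.orbit M (r t)) := by
    intro t t' htt
    rw [Function.onFun, Set.disjoint_left]
    intro x hx hx'
    refine htt (hr t t' ?_)
    rw [← MulAction.orbit_eq_iff.2 hx', MulAction.orbit_eq_iff.2 hx]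
    exact MulAction.mem_orbit_self _
  rw [hYU, finsum_mem_iUnion hdisj fun t => Set.finite_range _, ← smul_eq_mul, smul_finsum]
  refine finsum_congr fun t => ?_
  have hconst : ∑ᶠ x ∈ MulAction.orbit M (r t), F x =
      Nat.card (MulAction.orbit M (r t)) * F (r t) := by
    have h : ∀ x ∈ MulAction.orbit M (r t), F x = F (r t) := by
      rintro _ ⟨m, rfl⟩
      exact hF m _
    have hfin : (MulAction.orbit M (r t)).Finite := Set.finite_range _
    rw [finsum_mem_congr rfl h, finsum_mem_eq_finite_toFinset_sum _ hfin,
      Finset.sum_const, nsmul_eq_mul, Nat.card_eq_card_finite_toFinset hfin]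
  -- Orbit-stabilizer converts the weight `|Stab|⁻¹` into `|orbit| / |M|`.
  have hcard : (Nat.card (MulAction.orbit M (r t)) : ℂ) *
      Nat.card (MulAction.stabilizer M (r t)) = Nat.card M := by
    rw [← Nat.cast_mul, Nat.card_congr (MulAction.orbitEquivQuotientStabilizer M (r t)),
      ← Subgroup.card_eq_card_quotient_mul_card_subgroup]
  have h1 : (Nat.card M : ℂ) ≠ 0 := Nat.cast_ne_zero.2 Nat.card_pos.ne'
  have h2 : (Nat.card (MulAction.stabilizer M (r t)) : ℂ) ≠ 0 :=
    Nat.cast_ne_zero.2 Nat.card_pos.ne'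
  rw [hconst, smul_eq_mul]
  field_simp
  rw [← hcard]
  ring

/-! ### Classes of elements, triples and pairs as conjugation orbits -/

section Conjugation

variable {G : Type*} [Group G]

instance conjAct_finite [Finite G] : Finite (ConjAct G) :=
  inferInstanceAs (Finite G)

theorem card_stabilizer_conjAct {k : ℕ} (h : Fin k → G) :
    Nat.card (MulAction.stabilizer (ConjAct G) h) =
      Nat.card (Subgroup.centralizer (Set.range h)) := by
  refine Nat.card_congr (ConjAct.ofConjAct.toEquiv.subtypeEquiv fun a => ?_)
  change _ ↔ ConjAct.ofConjAct a ∈ Subgroup.centralizer (Set.range h)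
  rw [MulAction.mem_stabilizer_iff, funext_iff, Subgroup.mem_centralizer_iff, Set.forall_mem_range]
  refine forall_congr' fun i => ?_
  rw [Pi.smul_apply, ConjAct.smul_def, mul_inv_eq_iff_eq_mul, eq_comm]

theorem card_stabilizer_conjAct_self (h : G) :
    Nat.card (MulAction.stabilizer (ConjAct G) h) = Nat.card (Subgroup.centralizer {h}) := by
  refine Nat.card_congr (ConjAct.ofConjAct.toEquiv.subtypeEquiv fun a => ?_)
  change _ ↔ ConjAct.ofConjAct a ∈ Subgroup.centralizer {h}
  rw [MulAction.mem_stabilizer_iff, Subgroup.mem_centralizer_singleton_iff,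
    ConjAct.smul_def, mul_inv_eq_iff_eq_mul]

theorem mem_orbit_conjAct_tuple_iff {k : ℕ} (h h' : Fin k → G) :
    h' ∈ MulAction.orbit (ConjAct G) h ↔
      (Quotient.mk (tupleConj G k) h' = Quotient.mk _ h) := by
  rw [eq_comm, Quotient.eq]
  constructor
  · rintro ⟨a, rfl⟩
    exact ⟨ConjAct.ofConjAct a, fun i => rfl⟩
  · rintro ⟨a, ha⟩
    exact ⟨ConjAct.toConjAct a, funext fun i => (ha i).symm⟩

theorem card_centralizer_congr {a b : G} (h : IsConj a b) :
    Nat.card (Subgroup.centralizer {a}) = Nat.card (Subgroup.centralizer {b}) := by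
  rw [← card_stabilizer_conjAct_self, ← card_stabilizer_conjAct_self]
  have h' : a ∈ MulAction.orbit (ConjAct G) b := ConjAct.mem_orbit_conjAct.2 h
  exact Nat.card_congr
    (MulAction.stabilizerEquivStabilizerOfOrbitRel (MulAction.orbitRel_apply.2 h')).toEquiv

theorem finsum_conjClasses [Finite G] (F : G → ℂ) (hF : ∀ a g, F (a * g * a⁻¹) = F g) :
    ∑ᶠ c : ConjClasses G, (Nat.card (Subgroup.centralizer {Quotient.out c}) : ℂ)⁻¹ *
        F (Quotient.out c) = (Nat.card G : ℂ)⁻¹ * ∑ᶠ g, F g := by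
  have hout : ∀ c : ConjClasses G, ConjClasses.mk (Quotient.out c) = c := Quotient.out_eq
  have h := finsum_mem_eq_finsum_orbit_representatives (M := ConjAct G)
    (fun c : ConjClasses G => Quotient.out c) Set.univ
    (fun x => iff_of_true trivial ⟨ConjClasses.mk x, by
      rw [ConjAct.mem_orbit_conjAct, ← ConjClasses.mk_eq_mk_iff_isConj, hout]⟩)
    (fun t t' ht => by
      rwa [ConjAct.mem_orbit_conjAct, ← ConjClasses.mk_eq_mk_iff_isConj, hout, hout] at ht)
    F (fun a g => hF (ConjAct.ofConjAct a) g)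
  simp_rw [card_stabilizer_conjAct_self, finsum_mem_univ] at h
  exact h

/-- The equation `g 0 * g 1 * g 2 = 1` is invariant under conjugation, so its solutions form a union
of orbits, one for each class in `TripleClassesOne G`. -/
theorem finsum_tripleClassesOne [Finite G] (F : (Fin 3 → G) → ℂ)
    (hF : ∀ a g, F (fun i => a * g i * a⁻¹) = F g) :
    ∑ᶠ t : TripleClassesOne G, (Nat.card (Subgroup.centralizer (Set.range t.rep)) : ℂ)⁻¹ *
        F t.rep = (Nat.card G : ℂ)⁻¹ * ∑ᶠ g ∈ {g : Fin 3 → G | g 0 * g 1 * g 2 = 1}, F g := by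
  have hrep : ∀ t : TripleClassesOne G, Quotient.mk (tupleConj G 3) t.rep = t.1 :=
    fun t => t.2.choose_spec.1
  have h := finsum_mem_eq_finsum_orbit_representatives (M := ConjAct G)
    (fun t : TripleClassesOne G => t.rep) {g | g 0 * g 1 * g 2 = 1}
    (fun x => by
      constructor
      · intro hx
        refine ⟨⟨_, x, rfl, hx⟩, ?_⟩
        rw [mem_orbit_conjAct_tuple_iff, hrep]
      · rintro ⟨t, a, rfl⟩
        change a • t.rep 0 * a • t.rep 1 * a • t.rep 2 = 1
        rw [← smul_mul', ← smul_mul', t.rep_mul, smul_one])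
    (fun t t' ht => by
      rw [mem_orbit_conjAct_tuple_iff, hrep, hrep] at ht
      exact Subtype.ext ht)
    F (fun a g => hF (ConjAct.ofConjAct a) g)
  simp_rw [card_stabilizer_conjAct] at h
  exact h

/-- Since `r` is arbitrary and the right side does not mention it, this also gives independence of
the chosen representatives. -/
theorem finsum_pairClasses [Finite G] (r : TupleClasses G 2 → Fin 2 → G)
    (hr : ∀ t, Quotient.mk _ (r t) = t) (g₁ g₂ : G) (F : (Fin 2 → G) → ℂ)
    (hF : ∀ a g, F (fun i => a * g i * a⁻¹) = F g) :
    ∑ᶠ t ∈ pairClasses g₁ g₂, (Nat.card (Subgroup.centralizer {r t 0} ⊓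
        Subgroup.centralizer {r t 1} : Subgroup G) : ℂ)⁻¹ * F (r t) =
      (Nat.card G : ℂ)⁻¹ * ∑ᶠ h ∈ {h : Fin 2 → G | IsConj g₁ (h 0) ∧ IsConj g₂ (h 1)}, F h := by
  have hmem : ∀ x : Fin 2 → G, Quotient.mk _ x ∈ pairClasses g₁ g₂ ↔
      IsConj g₁ (x 0) ∧ IsConj g₂ (x 1) := by
    intro x
    refine ⟨?_, fun hx => ⟨x, rfl, hx⟩⟩
    rintro ⟨h, hh, h1, h2⟩
    obtain ⟨a, ha⟩ := Quotient.exact hh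
    exact ⟨h1.trans (isConj_iff.2 ⟨a, (ha 0).symm⟩), h2.trans (isConj_iff.2 ⟨a, (ha 1).symm⟩)⟩
  have h := finsum_mem_eq_finsum_orbit_representatives (M := ConjAct G)
    (fun t : pairClasses g₁ g₂ => r t.1) {h | IsConj g₁ (h 0) ∧ IsConj g₂ (h 1)}
    (fun x => by
      simp_rw [mem_orbit_conjAct_tuple_iff, hr]
      rw [Set.mem_ofPred_eq, ← hmem]
      exact ⟨fun hx => ⟨⟨_, hx⟩, rfl⟩, fun ⟨t, ht⟩ => ht ▸ t.2⟩)
    (fun t t' ht => by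
      rw [mem_orbit_conjAct_tuple_iff, hr, hr] at ht
      exact Subtype.ext ht)
    F (fun a g => hF (ConjAct.ofConjAct a) g)
  have hc : ∀ x : Fin 2 → G, Subgroup.centralizer (Set.range x) =
      Subgroup.centralizer {x 0} ⊓ Subgroup.centralizer {x 1} := by
    intro x
    ext a
    rw [Subgroup.mem_inf, Subgroup.mem_centralizer_iff, Set.forall_mem_range, Fin.forall_fin_two,
      Subgroup.mem_centralizer_singleton_iff, Subgroup.mem_centralizer_singleton_iff,
      eq_comm, eq_comm (a := x 1 * a)]
  simp_rw [card_stabilizer_conjAct, hc] at h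
  rw [← finsum_set_coe_eq_finsum_mem]
  exact h

end Conjugation

/-! ## The cohomology of the point -/

section PointCohomology

variable {G : Type*} [Group G]

/-- Reduces the integral over a sector to evaluation at its single point. -/
noncomputable instance fixedSpace_unique (S : Set G) : Unique (fixedSpace (ptRep G) S) where
  default := 0
  uniq := fun _ => Subtype.ext (Subsingleton.elim (α := Pt) _ _)

theorem form_eq_zero_of_subsingleton {E : Type*} [NormedAddCommGroup E] [NormedSpace ℝ E]
    [Subsingleton E] {k : ℕ} (w : E → E [⋀^Fin (k + 1)]→L[ℝ] ℂ) : w = 0 := by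
  funext x
  ext v
  exact (w x).map_coord_zero 0 (Subsingleton.elim _ _)

instance sectorCohomology_succ_subsingleton (c : ConjClasses G) (k : ℕ) :
    Subsingleton (SectorCohomology (ptRep G) c (k + 1)) := by
  refine subsingleton_of_forall_eq 0 fun a => ?_
  obtain ⟨w, rfl⟩ := SectorCohomology.mk_surjective _ _ _ a
  have hw : w = 0 := Subtype.ext (funext fun h => form_eq_zero_of_subsingleton _)
  rw [hw, map_zero]

/-- There are no nonzero exact `0`-forms, so a class of degree zero has exactly one closed
representative. The choice made in `SectorCohomology.rep` is thus forced, and in particular linear.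
-/
theorem sectorCohomology_mk_injective (c : ConjClasses G) :
    Function.Injective (SectorCohomology.mk (ptRep G) c 0) := by
  rw [injective_iff_map_eq_zero]
  intro w hw
  exact Subtype.ext ((SectorCohomology.mk_eq_zero _ _ _ _).1 hw)

/-- The value of a `0`-form on a point. -/
theorem form_apply_eq {E : Type*} [NormedAddCommGroup E] [NormedSpace ℝ E] [Subsingleton E]
    (w : E → E [⋀^Fin 0]→L[ℝ] ℂ) (x y : E) (u v : Fin 0 → E) : w x u = w y v := by
  rw [Subsingleton.elim x y, Subsingleton.elim u v]

/-- The members of a family are pull-backs of each other under conjugation, and pulling back a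
`0`-form between points preserves its value. -/
theorem closedForm_apply_eq {c : ConjClasses G} (w : closedForms (ptRep G) c 0)
    (h h' : {h : G // ConjClasses.mk h = c}) :
    w.1 h 0 Fin.elim0 = w.1 h' 0 Fin.elim0 := by
  obtain ⟨a, ha⟩ := isConj_iff.1 (ConjClasses.mk_eq_mk_iff_isConj.1 (h.2.trans h'.2.symm))
  have hh : h' = conjMem a h := Subtype.ext ha.symm
  rw [hh, ← w.2.1.2 h a]
  exact form_apply_eq (w.1 (conjMem a h)) _ _ _ _

/-- The value of the degree zero component of a class on each sector. -/
noncomputable def coeff : PtCohomology G →ₗ[ℂ] ConjClasses G → ℂ where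
  toFun α c := (α c 0).rep.1 ⟨Quotient.out c, Quotient.out_eq c⟩ 0 Fin.elim0
  map_add' α β := by
    funext c
    have h : (α c 0 + β c 0).rep = (α c 0).rep + (β c 0).rep :=
      sectorCohomology_mk_injective c (by
        rw [map_add, SectorCohomology.mk_rep, SectorCohomology.mk_rep, SectorCohomology.mk_rep])
    rw [Pi.add_apply, Pi.add_apply, h]
    rfl
  map_smul' z α := by
    funext c
    have h : (z • α c 0).rep = z • (α c 0).rep :=
      sectorCohomology_mk_injective c (by
        rw [map_smul, SectorCohomology.mk_rep, SectorCohomology.mk_rep])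
    rw [Pi.smul_apply, Pi.smul_apply, h]
    rfl

theorem formAt_apply (α : PtCohomology G) (g : G) (x : fixedSpace (ptRep G) {g})
    (v : Fin 0 → fixedSpace (ptRep G) {g}) : formAt α g x v = coeff α (ConjClasses.mk g) :=
  (form_apply_eq _ _ _ _ _).trans (closedForm_apply_eq _ _ _)

theorem coeff_injective : Function.Injective (coeff (G := G)) := by
  intro α β h
  funext c k
  cases k with
  | succ k => exact Subsingleton.elim _ _
  | zero =>
    rw [← SectorCohomology.mk_rep (ptRep G) (α c 0), ← SectorCohomology.mk_rep (ptRep G) (β c 0)]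
    congr 1
    refine Subtype.ext (funext fun g => funext fun x => ContinuousAlternatingMap.ext fun v => ?_)
    rw [form_apply_eq _ x 0 v Fin.elim0, closedForm_apply_eq _ g ⟨Quotient.out c, Quotient.out_eq c⟩,
      form_apply_eq ((β c 0).rep.1 g) x 0 v Fin.elim0,
      closedForm_apply_eq (β c 0).rep g ⟨Quotient.out c, Quotient.out_eq c⟩]
    exact congrFun h c

/-- Computes `coeff` from any known representative, bypassing the choice in `rep`. -/
theorem coeff_apply_of_mk (α : PtCohomology G) (c : ConjClasses G)
    (w : closedForms (ptRep G) c 0) (h : α c 0 = SectorCohomology.mk _ c 0 w) :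
    coeff α c = w.1 ⟨Quotient.out c, Quotient.out_eq c⟩ 0 Fin.elim0 := by
  have hw : (α c 0).rep = w := sectorCohomology_mk_injective c
    ((SectorCohomology.mk_rep _ _).trans h)
  rw [← hw]
  rfl

theorem coeff_surjective : Function.Surjective (coeff (G := G)) := by
  intro f
  refine ⟨fun c => Pi.single 0 (SectorCohomology.mk _ c 0 (f c • oneForm _ c)), ?_⟩
  funext c
  rw [coeff_apply_of_mk _ c (f c • oneForm _ c) (Pi.single_eq_same _ _)]
  exact mul_one (f c)

/-- The cohomology of the point with trivial action is the space of functions on the set of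
conjugacy classes. -/
noncomputable def coeffEquiv : PtCohomology G ≃ₗ[ℂ] ConjClasses G → ℂ :=
  LinearEquiv.ofBijective coeff ⟨coeff_injective, coeff_surjective⟩

open Classical in
theorem coeff_ptClass (g : G) : coeff (ptClass g) = Pi.single (ConjClasses.mk g) 1 := by
  funext c
  by_cases hc : c = ConjClasses.mk g
  · subst hc
    rw [Pi.single_eq_same, coeff_apply_of_mk _ _ (oneForm _ _)]
    · rfl
    · rw [ptClass, sectorUnit, Pi.single_eq_same, Pi.single_eq_same]
  · rw [Pi.single_eq_of_ne hc, coeff_apply_of_mk _ _ 0]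
    · rfl
    · rw [ptClass, sectorUnit, Pi.single_eq_of_ne hc, map_zero, Pi.zero_apply]

/-- The characteristic polynomial has degree `dim ℂ⁰ = 0`, so there are no eigenvalues to sum over.
-/
theorem degreeShift_ptRep (g : G) : degreeShift (ptRep G) g = 0 := by
  have h : (LinearMap.charpoly (ptRep G g)).roots = 0 := by
    rw [← Multiset.card_eq_zero, ← Nat.le_zero]
    refine (Polynomial.card_roots' _).trans ?_
    rw [LinearMap.charpoly_natDegree]
    simp
  rw [degreeShift, h, Multiset.map_zero, Multiset.sum_zero]

theorem orbDegree_ptRep : orbDegree (ptRep G) 0 = ⊤ := by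
  rw [eq_top_iff]
  intro α _ g k hk
  cases k with
  | succ k => exact Subsingleton.elim _ _
  | zero => exact absurd (by rw [degreeShift_ptRep]; simp) hk

theorem exists_basis_ptClass [Finite G] : ∃ b : Module.Basis (ConjClasses G) ℂ (PtCohomology G),
    ∀ g : G, b (ConjClasses.mk g) = ptClass g := by
  classical
  refine ⟨Module.Basis.ofEquivFun coeffEquiv, fun g => coeff_injective ?_⟩
  rw [coeff_ptClass, Module.Basis.coe_ofEquivFun]
  exact coeffEquiv.apply_symm_apply _

/-! ## Orbifold integrals -/

theorem orbIntegral_eq (S : Set G)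
    (w : fixedSpace (ptRep G) S → fixedSpace (ptRep G) S [⋀^Fin 0]→L[ℝ] ℂ) :
    orbIntegral S w = (Nat.card (Subgroup.centralizer S) : ℂ)⁻¹ * w 0 Fin.elim0 := by
  rw [orbIntegral, finsum_unique]
  rfl

/-- Homomorphisms into `ℂ⁰` are all zero, so the rank is `0` and the convention `0 ^ 0 = 1` applies.
-/
theorem eulerForm_apply (g : Fin 3 → G) (hg : g 0 * g 1 * g 2 = 1)
    (x : fixedSpace (ptRep G) (Set.range g)) (v) : eulerForm g hg x v = 1 := by
  have : Subsingleton (obstructionFibre g hg) :=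
    ⟨fun a b => Subtype.ext (AddMonoidHom.ext fun _ => Subsingleton.elim (α := Pt) _ _)⟩
  change (0 : ℂ) ^ Module.finrank ℂ (obstructionFibre g hg) = 1
  rw [Module.finrank_zero_of_subsingleton, pow_zero]

theorem pairing_eq (α β : PtCohomology G) : pairing α β =
    ∑ᶠ c : ConjClasses G, (Nat.card (Subgroup.centralizer {Quotient.out c}) : ℂ)⁻¹ *
      (coeff α (ConjClasses.mk (Quotient.out c)) *
        coeff β (ConjClasses.mk (Quotient.out c)⁻¹)) := by
  refine finsum_congr fun c => ?_
  -- The point and the empty tuple given to `formAt β` are exactly those produced by `pullback`, so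
  -- that `rfl` closes the goal.
  rw [orbIntegral_eq, ← formAt_apply α _ 0 Fin.elim0, ← formAt_apply β _
    (inclusion (ptRep G) (fixedSpace_le_inv (Quotient.out c)) 0)
    (inclusion (ptRep G) (fixedSpace_le_inv (Quotient.out c)) ∘ Fin.elim0)]
  rfl

theorem evalPullback_apply (α : PtCohomology G) (g : Fin 3 → G) (i : Fin 3)
    (x : fixedSpace (ptRep G) (Set.range g)) (v) :
    evalPullback α g i x v = coeff α (ConjClasses.mk (g i)) :=
  formAt_apply _ _ _ _

theorem threePoint_eq (α β γ : PtCohomology G) : threePoint α β γ =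
    ∑ᶠ t : TripleClassesOne G, (Nat.card (Subgroup.centralizer (Set.range t.rep)) : ℂ)⁻¹ *
      (coeff α (ConjClasses.mk (t.rep 0)) * coeff β (ConjClasses.mk (t.rep 1)) *
        coeff γ (ConjClasses.mk (t.rep 2))) := by
  refine finsum_congr fun t => ?_
  rw [orbIntegral_eq, ← evalPullback_apply α t.rep 0 0 Fin.elim0,
    ← evalPullback_apply β t.rep 1 0 Fin.elim0, ← evalPullback_apply γ t.rep 2 0 Fin.elim0]
  congr 1
  refine Eq.trans ?_ (mul_one _)
  rw [← eulerForm_apply t.rep t.rep_mul 0 Fin.elim0]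
  rfl

theorem mk_conj (a g : G) : ConjClasses.mk (a * g * a⁻¹) = ConjClasses.mk g :=
  ConjClasses.mk_eq_mk_iff_isConj.2 (isConj_iff.2 ⟨a, rfl⟩).symm

theorem mk_conj_inv (a g : G) : ConjClasses.mk (a * g * a⁻¹)⁻¹ = ConjClasses.mk g⁻¹ := by
  rw [← mk_conj a g⁻¹, conj_inv]

/-- Only the sector of `g` contributes; centralizer order and inverse class do not depend on the
representative picked by `Quotient.out`. -/
theorem pairing_ptClass_left (g : G) (γ : PtCohomology G) : pairing (ptClass g) γ =
    (Nat.card (Subgroup.centralizer {g}) : ℂ)⁻¹ * coeff γ (ConjClasses.mk g⁻¹) := by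
  classical
  rw [pairing_eq, finsum_eq_single _ (ConjClasses.mk g)]
  · have h : ConjClasses.mk (Quotient.out (ConjClasses.mk g)) = ConjClasses.mk g :=
      Quotient.out_eq _
    have hg := ConjClasses.mk_eq_mk_iff_isConj.1 h
    obtain ⟨a, ha⟩ := isConj_iff.1 hg.symm
    rw [coeff_ptClass, h, Pi.single_eq_same, one_mul, card_centralizer_congr hg, ← ha, mk_conj_inv]
  · intro c hc
    have h : ConjClasses.mk (Quotient.out c) = c := Quotient.out_eq _
    rw [coeff_ptClass, h, Pi.single_eq_of_ne hc, zero_mul, mul_zero]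

theorem pairing_ptClass_inv (g : G) : pairing (ptClass g) (ptClass g⁻¹) =
    (Nat.card (Subgroup.centralizer {g}) : ℂ)⁻¹ := by
  classical
  rw [pairing_ptClass_left, coeff_ptClass, Pi.single_eq_same, mul_one]

theorem pairing_ptClass_of_not_isConj (g h : G) (hgh : ¬ IsConj g⁻¹ h) :
    pairing (ptClass g) (ptClass h) = 0 := by
  classical
  rw [pairing_ptClass_left, coeff_ptClass, Pi.single_eq_of_ne, mul_zero]
  rwa [Ne, ConjClasses.mk_eq_mk_iff_isConj]

/-! ### Pairing and 3-point function as sums over group elements -/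

variable [Finite G]

theorem pairing_eq_finsum (α β : PtCohomology G) : pairing α β =
    (Nat.card G : ℂ)⁻¹ * ∑ᶠ g : G, coeff α (ConjClasses.mk g) * coeff β (ConjClasses.mk g⁻¹) := by
  rw [pairing_eq, finsum_conjClasses fun g => coeff α (ConjClasses.mk g) *
    coeff β (ConjClasses.mk g⁻¹)]
  intro a g
  rw [mk_conj, mk_conj_inv]

theorem threePoint_eq_finsum (α β γ : PtCohomology G) : threePoint α β γ =
    (Nat.card G : ℂ)⁻¹ * ∑ᶠ g ∈ {g : Fin 3 → G | g 0 * g 1 * g 2 = 1},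
      coeff α (ConjClasses.mk (g 0)) * coeff β (ConjClasses.mk (g 1)) *
        coeff γ (ConjClasses.mk (g 2)) := by
  rw [threePoint_eq, finsum_tripleClassesOne fun g => coeff α (ConjClasses.mk (g 0)) *
    coeff β (ConjClasses.mk (g 1)) * coeff γ (ConjClasses.mk (g 2))]
  intro a g
  simp_rw [mk_conj]

theorem pairing_comm (α β : PtCohomology G) : pairing α β = pairing β α := by
  rw [pairing_eq_finsum, pairing_eq_finsum, ← finsum_comp_equiv (Equiv.inv G)]
  simp_rw [Equiv.inv_apply, inv_inv, mul_comm]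

/-- Nondegeneracy: pairing with `ptClass g⁻¹` reads off the coefficient at `g`, up to the nonzero
factor `|C(g⁻¹)|⁻¹`. -/
theorem eq_of_pairing_eq {δ δ' : PtCohomology G} (h : ∀ γ, pairing δ γ = pairing δ' γ) :
    δ = δ' := by
  refine coeff_injective (funext fun c => ?_)
  obtain ⟨g, rfl⟩ := ConjClasses.mk_surjective c
  have hg := h (ptClass g⁻¹)
  rw [pairing_comm, pairing_ptClass_left, pairing_comm, pairing_ptClass_left, inv_inv] at hg
  exact mul_left_cancel₀ (inv_ne_zero (Nat.cast_ne_zero.2 Nat.card_pos.ne')) hg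

end PointCohomology

/-! ## The center of the group algebra -/

section Center

variable {G : Type*} [Group G]

theorem mem_center_monoidAlgebra_iff (z : MonoidAlgebra ℂ G) :
    z ∈ Subalgebra.center ℂ (MonoidAlgebra ℂ G) ↔ ∀ a g, z.coeff (a * g * a⁻¹) = z.coeff g := by
  rw [Subalgebra.mem_center_iff]
  constructor
  · intro h a g
    -- At `a * g`, the products `a z` and `z a` have coefficients `z(g)` and `z(a g a⁻¹)`.
    have h' := congrArg (fun x => x.coeff (a * g)) (h (MonoidAlgebra.single a 1))
    simpa using h'.symm
  · intro h b
    induction b using MonoidAlgebra.induction_linear with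
    | zero => rw [zero_mul, mul_zero]
    | add x y hx hy => rw [add_mul, mul_add, hx, hy]
    | single a r =>
      ext g
      rw [MonoidAlgebra.coeff_single_mul_apply, MonoidAlgebra.coeff_mul_single_apply, mul_comm,
        ← h a (a⁻¹ * g), mul_inv_cancel_left]

variable [Finite G]

/-- The element of the group algebra whose coefficients are the values of a class on the
sectors. -/
noncomputable def toGroupAlgebra : PtCohomology G →ₗ[ℂ] MonoidAlgebra ℂ G where
  toFun α := MonoidAlgebra.ofCoeff
    (Finsupp.equivFunOnFinite.symm fun g => coeff α (ConjClasses.mk g))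
  map_add' α β := by
    ext g
    simp
  map_smul' z α := by
    ext g
    simp

theorem coeff_toGroupAlgebra (α : PtCohomology G) (g : G) :
    (toGroupAlgebra α).coeff g = coeff α (ConjClasses.mk g) := rfl

/-- The identification of the cohomology of the point with the center of the group algebra. -/
noncomputable def toCenter :
    PtCohomology G ≃ₗ[ℂ] Subalgebra.center ℂ (MonoidAlgebra ℂ G) :=
  LinearEquiv.ofBijective
    (LinearMap.codRestrict (Subalgebra.toSubmodule (Subalgebra.center ℂ (MonoidAlgebra ℂ G)))
      toGroupAlgebra fun α => (mem_center_monoidAlgebra_iff _).2 fun a g => by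
        rw [coeff_toGroupAlgebra, coeff_toGroupAlgebra, mk_conj])
    (by
      constructor
      · intro α β h
        refine coeff_injective (funext fun c => ?_)
        obtain ⟨g, rfl⟩ := ConjClasses.mk_surjective c
        exact congrArg (fun x => x.1.coeff g) h
      · rintro ⟨z, hz⟩
        -- A central element is constant on conjugacy classes, so its values at representatives
        -- determine it.
        obtain ⟨α, hα⟩ := coeff_surjective (G := G) fun c => z.coeff (Quotient.out c)
        refine ⟨α, Subtype.ext ?_⟩
        ext g
        change coeff α (ConjClasses.mk g) = _
        rw [hα]
        have hg : IsConj (Quotient.out (ConjClasses.mk g)) g :=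
          ConjClasses.mk_eq_mk_iff_isConj.1 (Quotient.out_eq _)
        obtain ⟨a, ha⟩ := isConj_iff.1 hg
        exact ((mem_center_monoidAlgebra_iff z).1 hz a _).symm.trans (congrArg z.coeff ha))

theorem coeff_toCenter (α : PtCohomology G) (g : G) :
    (toCenter α : MonoidAlgebra ℂ G).coeff g = coeff α (ConjClasses.mk g) := rfl

theorem toCenter_ptClass (g : G) : (toCenter (ptClass g) : MonoidAlgebra ℂ G) =
    ∑ᶠ h ∈ {h : G | IsConj g h}, MonoidAlgebra.of ℂ G h := by
  classical
  ext k
  have hfin : {h : G | IsConj g h}.Finite := Set.toFinite _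
  rw [coeff_toCenter, coeff_ptClass, finsum_mem_eq_finite_toFinset_sum _ hfin,
    MonoidAlgebra.coeff_sum, Finsupp.finsetSum_apply]
  simp only [MonoidAlgebra.of_apply, MonoidAlgebra.coeff_single, Finsupp.single_apply]
  rw [Finset.sum_ite_eq', Pi.single_apply]
  refine if_congr ?_ rfl rfl
  rw [Set.Finite.mem_toFinset, ConjClasses.mk_eq_mk_iff_isConj, isConj_comm]
  rfl

theorem toCenter_ptClass_one : toCenter (ptClass (1 : G)) = 1 := by
  refine Subtype.ext ?_
  have h : {h : G | IsConj 1 h} = {1} := Set.ext fun h => isConj_one_right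
  rw [toCenter_ptClass, h, finsum_mem_singleton, map_one]
  rfl

/-! ## The cup product -/

theorem coeff_mul_eq_finsum (x y : MonoidAlgebra ℂ G) (g : G) :
    (x * y).coeff g = ∑ᶠ h, x.coeff h * y.coeff (h⁻¹ * g) := by
  have := Fintype.ofFinite G
  rw [MonoidAlgebra.coeff_mul_apply_left, finsum_eq_sum_of_fintype,
    Finsupp.sum_fintype _ _ fun i => zero_mul _]

/-- The coefficient of `1` in a product collects exactly the pairs `(h, h⁻¹)`, which are the pairs
matched by `I`. -/
theorem pairing_eq_coeff_mul (α β : PtCohomology G) : pairing α β =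
    (Nat.card G : ℂ)⁻¹ * (toCenter α * toCenter β : MonoidAlgebra ℂ G).coeff 1 := by
  rw [pairing_eq_finsum, coeff_mul_eq_finsum]
  simp_rw [mul_one, coeff_toCenter]

theorem threePoint_eq_finsum_prod (α β γ : PtCohomology G) : threePoint α β γ =
    (Nat.card G : ℂ)⁻¹ * ∑ᶠ p : G × G, coeff α (ConjClasses.mk p.1) *
      coeff β (ConjClasses.mk p.2) * coeff γ (ConjClasses.mk (p.1 * p.2)⁻¹) := by
  -- Triples with product `1` are parametrized by their first two entries.
  have hinj : Function.Injective fun p : G × G => ![p.1, p.2, (p.1 * p.2)⁻¹] :=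
    fun p q h => Prod.ext (congrFun h 0) (congrFun h 1)
  have hrange : {g : Fin 3 → G | g 0 * g 1 * g 2 = 1} =
      Set.range fun p : G × G => ![p.1, p.2, (p.1 * p.2)⁻¹] := by
    ext g
    constructor
    · intro hg
      refine ⟨(g 0, g 1), funext fun i => ?_⟩
      fin_cases i
      · rfl
      · rfl
      · exact (eq_inv_of_mul_eq_one_right hg).symm
    · rintro ⟨p, rfl⟩
      exact mul_inv_cancel (p.1 * p.2)
  rw [threePoint_eq_finsum, hrange, finsum_mem_range hinj]
  rfl

theorem threePoint_eq_coeff_mul (α β γ : PtCohomology G) : threePoint α β γ =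
    (Nat.card G : ℂ)⁻¹ *
      (toCenter α * toCenter β * toCenter γ : MonoidAlgebra ℂ G).coeff 1 := by
  have := Fintype.ofFinite G
  rw [threePoint_eq_finsum_prod, mul_assoc, coeff_mul_eq_finsum]
  simp_rw [mul_one, coeff_mul_eq_finsum, finsum_eq_sum_of_fintype, Fintype.sum_prod_type,
    Finset.mul_sum, coeff_toCenter, mul_inv_rev, mul_assoc]

/-- In terms of the trace `τ`, both sides of the relation are `|G|⁻¹ τ(Ψα Ψβ Ψγ)`. -/
theorem isOrbCup_toCenter_symm (α β : PtCohomology G) :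
    IsOrbCup α β (toCenter.symm (toCenter α * toCenter β)) := by
  intro γ
  rw [pairing_eq_coeff_mul, threePoint_eq_coeff_mul, LinearEquiv.apply_symm_apply]
  rfl

theorem IsOrbCup.unique {α β δ δ' : PtCohomology G} (h : IsOrbCup α β δ)
    (h' : IsOrbCup α β δ') : δ = δ' :=
  eq_of_pairing_eq fun γ => (h γ).trans (h' γ).symm

theorem isOrbCup_orbCup (α β : PtCohomology G) : IsOrbCup α β (orbCup α β) :=
  Classical.epsilon_spec (p := IsOrbCup α β) ⟨_, isOrbCup_toCenter_symm α β⟩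

theorem toCenter_orbCup (α β : PtCohomology G) :
    toCenter (orbCup α β) = toCenter α * toCenter β := by
  rw [(isOrbCup_orbCup α β).unique (isOrbCup_toCenter_symm α β), LinearEquiv.apply_symm_apply]

/-- Pairing with a class on the right, as a linear form. -/
noncomputable def pairingRight (γ : PtCohomology G) : PtCohomology G →ₗ[ℂ] ℂ where
  toFun δ := pairing δ γ
  map_add' δ δ' := by
    simp_rw [pairing_eq_coeff_mul, map_add, Subalgebra.coe_add, add_mul, MonoidAlgebra.coeff_add,
      Finsupp.add_apply, mul_add]
  map_smul' z δ := by
    simp_rw [pairing_eq_coeff_mul, map_smul, Subalgebra.coe_smul, smul_mul_assoc,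
      MonoidAlgebra.coeff_smul_apply, mul_smul_comm, RingHom.id_apply]

/-- The coefficients of the two classes are indicator functions, which cut the sum over `G × G` down
to `(g₁) × (g₂)`. -/
theorem threePoint_ptClass (g₁ g₂ : G) (γ : PtCohomology G) :
    threePoint (ptClass g₁) (ptClass g₂) γ = (Nat.card G : ℂ)⁻¹ *
      ∑ᶠ h ∈ {h : Fin 2 → G | IsConj g₁ (h 0) ∧ IsConj g₂ (h 1)},
        coeff γ (ConjClasses.mk (h 0 * h 1)⁻¹) := by
  classical
  rw [threePoint_eq_finsum_prod, ← finsum_comp_equiv (finTwoArrowEquiv G), coeff_ptClass,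
    coeff_ptClass]
  congr 1
  refine finsum_congr fun h => ?_
  rw [finsum_eq_if]
  change Pi.single (M := fun _ => ℂ) _ 1 (ConjClasses.mk (h 0)) *
    Pi.single (M := fun _ => ℂ) _ 1 (ConjClasses.mk (h 1)) *
    coeff γ (ConjClasses.mk (h 0 * h 1)⁻¹) = _
  simp only [Pi.single_apply, ConjClasses.mk_eq_mk_iff_isConj, isConj_comm (g := h 0),
    isConj_comm (g := h 1), Set.mem_ofPred_eq, ← ite_and, mul_ite, ite_mul, mul_one, mul_zero,
    one_mul, zero_mul, and_comm]

/-- By uniqueness it is enough to pair the right side with every `γ`. The numerator `|C(h₁h₂)|`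
cancels the factor `|C(h₁h₂)|⁻¹` of `⟨x_(h₁h₂), γ⟩`, which leaves `|C(h₁) ∩ C(h₂)|⁻¹`, the weight of
the class of `(h₁, h₂)` in the orbit count. -/
theorem orbCup_ptClass (r : TupleClasses G 2 → Fin 2 → G) (hr : ∀ t, Quotient.mk _ (r t) = t)
    (g₁ g₂ : G) : orbCup (ptClass g₁) (ptClass g₂) =
      ∑ᶠ t ∈ pairClasses g₁ g₂,
        ((Nat.card (Subgroup.centralizer {r t 0 * r t 1}) : ℂ) /
          (Nat.card (Subgroup.centralizer {r t 0} ⊓ Subgroup.centralizer {r t 1} :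
            Subgroup G) : ℂ)) • ptClass (r t 0 * r t 1) := by
  refine (isOrbCup_orbCup _ _).unique fun γ => ?_
  rw [threePoint_ptClass, ← finsum_pairClasses r hr g₁ g₂ fun h =>
    coeff γ (ConjClasses.mk (h 0 * h 1)⁻¹)]
  · change pairingRight γ _ = _
    rw [← LinearMap.toAddMonoidHom_coe, AddMonoidHom.map_finsum_mem _ _ (Set.toFinite _)]
    refine finsum_mem_congr rfl fun t _ => ?_
    rw [LinearMap.toAddMonoidHom_coe, map_smul]
    change _ • pairing _ γ = _
    rw [pairing_ptClass_left, smul_eq_mul, div_eq_inv_mul, mul_assoc, mul_inv_cancel_left₀]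
    exact Nat.cast_ne_zero.2 Nat.card_pos.ne'
  -- The summand is invariant because conjugating both factors conjugates their product.
  · intro a g
    rw [← mk_conj_inv a (g 0 * g 1)]
    simp only [mul_assoc, inv_mul_cancel_left]

end Center

end OrbifoldCohomology

open OrbifoldCohomology in
theorem mainTheorem10 (G : Type*) [Group G] [Finite G] :
    -- all degree shifting numbers vanish, and the cohomology lives in degree zero
    (∀ g : G, degreeShift (ptRep G) g = 0) ∧
    orbDegree (ptRep G) 0 = ⊤ ∧
    -- the classes of the sectors form a basis
    (∃ b : Module.Basis (ConjClasses G) ℂ (PtCohomology G),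
      ∀ g : G, b (ConjClasses.mk g) = ptClass g) ∧
    -- the Poincaré pairing in this basis
    (∀ g : G, pairing (ptClass g) (ptClass g⁻¹) =
      (Nat.card (Subgroup.centralizer {g}) : ℂ)⁻¹) ∧
    (∀ g h : G, ¬ IsConj g⁻¹ h → pairing (ptClass g) (ptClass h) = 0) ∧
    -- the cup product is well defined by its defining relation
    (∀ α β : PtCohomology G, ∃! δ : PtCohomology G, IsOrbCup α β δ) ∧
    -- the product formula, for any choice of representatives of the classes of pairs
    (∀ r : TupleClasses G 2 → Fin 2 → G, (∀ t, Quotient.mk _ (r t) = t) → ∀ g₁ g₂ : G,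
      orbCup (ptClass g₁) (ptClass g₂) =
        ∑ᶠ t ∈ pairClasses g₁ g₂,
          ((Nat.card (Subgroup.centralizer {r t 0 * r t 1}) : ℂ) /
            (Nat.card (Subgroup.centralizer {r t 0} ⊓ Subgroup.centralizer {r t 1} :
              Subgroup G) : ℂ)) • ptClass (r t 0 * r t 1)) ∧
    -- the identification with the center of the group algebra
    ∃ Ψ : PtCohomology G ≃ₗ[ℂ] Subalgebra.center ℂ (MonoidAlgebra ℂ G),
      (∀ g : G, (Ψ (ptClass g) : MonoidAlgebra ℂ G) =
        ∑ᶠ h ∈ {h : G | IsConj g h}, MonoidAlgebra.of ℂ G h) ∧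
      (∀ α β : PtCohomology G, Ψ (orbCup α β) = Ψ α * Ψ β) ∧
      Ψ (ptClass 1) = 1 := by
  exact ⟨degreeShift_ptRep, orbDegree_ptRep, exists_basis_ptClass, pairing_ptClass_inv,
    pairing_ptClass_of_not_isConj,
    fun α β => ⟨_, isOrbCup_toCenter_symm α β, fun _ h => h.unique (isOrbCup_toCenter_symm α β)⟩,
    orbCup_ptClass, toCenter, toCenter_ptClass, toCenter_orbCup, toCenter_ptClass_one⟩
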